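/- Let $N\ge 1$, let $\mathbb B$ be the open unit ball of $\mathbb C^N$ with $\langle z,w\rangle=\sum_i z_i\overline{w_i}$, let $\mu$ be Lebesgue measure on $\mathbb B$ normalized by $\mu(\mathbb B)=1$, and for $a\in\mathbb R$ put $d\mu_a(z)=(1-|z|^2)^a\,d\mu(z)$. Let $1<p<\infty$, $p'=p/(p-1)$, and let $s,t,q,Q\in\mathbb R$ with $s>-1$. For $a>-(N+1)$ let $K_a(z,w)=(1-\langle z,w\rangle)^{-(N+1+a)}$ (principal branch). For $s+t>-(N+1)$ define $$P_{s,t}f(z)=(1-|z|^2)^t\int_{\mathbb B}K_{s+t}(z,w)f(w)(1-|w|^2)^{s-q}\,d\mu_q(w).$$ Let $\omega$ be a weight on $\mathbb B$, i.e. a non-negative locally integrable function. We say that $P_{s,t}$ is well defined and continuous from $L^p(\omega\,d\mu_q)$ to $L^p(\omega\,d\mu_Q)$ if for every $f\in L^p(\omega\, d\mu_q)$ the above integral converges absolutely for almost every $z\in\mathbb B$ and $\|P_{s,t}f\|_{L^p(\omega d\mu_Q)}\le C\|f\|_{L^p(\omega d\mu_q)}$ with a constant $C<\infty$ independent of $f$.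 Let $d(z,w)=\big||z|-|w|\big|+\big|1-\frac{\langle z,w\rangle}{|z||w|}\big|$ for $z,w\neq0$ and $d(z,w)=|z|+|w|$ if $z=0$ or $w=0$. A pseudo-ball is a set $B=\{z\in\mathbb B: d(z,\zeta)<R_B\}$ with centre $\zeta\in\mathbb B$ and radius $0<R_B\le 3$ (since $d<3$ on $\mathbb B\times\mathbb B$, larger radii give no further sets); it touches the boundary if $d(z,\zeta)<R_B$ for some $z\in\partial\mathbb B$. Put $\nu(B)=R_B^{N+1+s+t}$ if $-(N+1)<s+t<-1$ and $\nu(B)=\mu_{s+t}(B)$ if $s+t>-1$. The weight $\omega$ belongs to the class $K_p^{s,t,q,Q}$ if $$\sup_{B}\left(\frac{R_B^{(Q-q)/p}}{\nu(B)}\int_B\omega\,d\mu_{Q+pt}\right)\left(\frac{R_B^{(Q-q)/p}}{\nu(B)}\int_B\omega^{-\frac1{p-1}}\,d\mu_{q+p'(s-q)}\right)^{p-1}<\infty,$$ where the supremum is over all pseudo-balls $B$ that touch the boundary. Assume that either $-(N+1)<s+t<-1$ and $s+t+\frac{Q-q}{p}>-1$, or $s+t>-1$ and $Q\ge q$. If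 $P_{s,t}$ is well defined and continuous from $L^p(\omega\,d\mu_q)$ to $L^p(\omega\,d\mu_Q)$, then $\omega\in K_p^{s,t,q,Q}$. -/

import Mathlib

open MeasureTheory
open scoped ENNReal

namespace BergmanBesov

noncomputable section

/-- Complex `N`-space with its Hermitian norm. -/
abbrev CSpace (N : ℕ) : Type := EuclideanSpace ℂ (Fin N)

/-- The open unit ball of `ℂ^N`. -/
def unitBall (N : ℕ) : Set (CSpace N) := Metric.ball 0 1

/-- The product `⟨z, w⟩ = ∑ z_i * conj w_i`, linear in the first variable
(Mathlib's `inner` is linear in the second one). -/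
def herm {N : ℕ} (z w : CSpace N) : ℂ := inner ℂ w z

/-- Lebesgue measure on the unit ball, normalized to total mass one. -/
def ballMeasure (N : ℕ) : Measure (CSpace N) :=
  (volume (unitBall N))⁻¹ • volume.restrict (unitBall N)

/-- `dμ_a(z) = (1 - |z|²)^a dμ(z)` on the unit ball, for any real `a`. -/
def muMeasure (N : ℕ) (a : ℝ) : Measure (CSpace N) :=
  (ballMeasure N).withDensity fun z => ENNReal.ofReal ((1 - ‖z‖ ^ 2) ^ a)

/-- `ω dμ_a`. -/
def weightedMeasure {N : ℕ} (ω : CSpace N → ℝ) (a : ℝ) : Measure (CSpace N) :=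
  (muMeasure N a).withDensity fun z => ENNReal.ofReal (ω z)

/-- A weight on the unit ball: a locally integrable non-negative function. -/
structure IsWeight {N : ℕ} (ω : CSpace N → ℝ) : Prop where
  nonneg : ∀ z ∈ unitBall N, 0 ≤ ω z
  locallyIntegrable : LocallyIntegrableOn ω (unitBall N) volume

/-- The Bergman-Besov kernel `K_a`, with the principal branch of the power. -/
def kernel {N : ℕ} (a : ℝ) (z w : CSpace N) : ℂ :=
  if -((N : ℝ) + 1) < a then
    1 / (1 - herm z w) ^ (((N : ℝ) + 1 + a : ℝ) : ℂ)
  else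
    ordinaryHypergeometric (1 : ℂ) 1 ((1 - (N + a) : ℝ) : ℂ) (herm z w)

/-- The integrand, with respect to `dμ_q(w)`, of `P_{s,t} f(z)`. -/
def opIntegrand {N : ℕ} (s t q : ℝ) (f : CSpace N → ℂ) (z w : CSpace N) : ℂ :=
  kernel (s + t) z w * f w * (((1 - ‖w‖ ^ 2) ^ (s - q) : ℝ) : ℂ)

/-- `P_{s,t} f(z) = (1-|z|²)^t ∫ K_{s+t}(z,w) f(w) (1-|w|²)^{s-q} dμ_q(w)`. -/
def opP {N : ℕ} (s t q : ℝ) (f : CSpace N → ℂ) (z : CSpace N) : ℂ :=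
  (((1 - ‖z‖ ^ 2) ^ t : ℝ) : ℂ) * ∫ w, opIntegrand s t q f z w ∂(muMeasure N q)

/-- `P_{s,t}` is well defined and continuous from `L^p(ω dμ_q)` to `L^p(ω dμ_Q)`: for every
`f ∈ L^p(ω dμ_q)` the integral defining `P_{s,t} f(z)` converges absolutely for almost every
`z` in the ball, `P_{s,t} f` is in `L^p(ω dμ_Q)`, and its norm is at most a constant times
that of `f`. -/
def IsBoundedP {N : ℕ} (p s t q Q : ℝ) (ω : CSpace N → ℝ) : Prop :=
  ∃ C : ℝ, 0 ≤ C ∧ ∀ f : CSpace N → ℂ,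
    MemLp f (ENNReal.ofReal p) (weightedMeasure ω q) →
      (∀ᵐ z ∂(ballMeasure N), Integrable (opIntegrand s t q f z) (muMeasure N q)) ∧
      MemLp (opP s t q f) (ENNReal.ofReal p) (weightedMeasure ω Q) ∧
      eLpNorm (opP s t q f) (ENNReal.ofReal p) (weightedMeasure ω Q) ≤
        ENNReal.ofReal C * eLpNorm f (ENNReal.ofReal p) (weightedMeasure ω q)

open Classical in
/-- The pseudo-distance `d(z,w) = ||z|-|w|| + |1 - ⟨z,w⟩/(|z||w|)|`, with the usual convention
`d(z,w) = |z| + |w|` when `z` or `w` is the origin. -/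
def pseudoDist {N : ℕ} (z w : CSpace N) : ℝ :=
  if z = 0 ∨ w = 0 then ‖z‖ + ‖w‖
  else |‖z‖ - ‖w‖| + ‖1 - herm z w / ((‖z‖ * ‖w‖ : ℝ) : ℂ)‖

/-- The pseudo-ball with centre `ζ` and radius `R` in the unit ball. -/
def pseudoBall {N : ℕ} (ζ : CSpace N) (R : ℝ) : Set (CSpace N) :=
  {z ∈ unitBall N | pseudoDist z ζ < R}

/-- The pseudo-ball reaches the unit sphere: some boundary point is at pseudo-distance less
than `R` from the centre. -/
def TouchesBoundary {N : ℕ} (ζ : CSpace N) (R : ℝ) : Prop :=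
  ∃ z : CSpace N, ‖z‖ = 1 ∧ pseudoDist z ζ < R

/-- The factor `R_B^{(Q-q)/p} / μ_{s+t}(B)` if `s + t > -1`, and
`R_B^{(Q-q)/p} / R_B^{N+1+s+t}` otherwise. -/
def kFactor {N : ℕ} (p s t q Q : ℝ) (ζ : CSpace N) (R : ℝ) : ℝ≥0∞ :=
  ENNReal.ofReal (R ^ ((Q - q) / p)) /
    (if -1 < s + t then muMeasure N (s + t) (pseudoBall ζ R)
      else ENNReal.ofReal (R ^ ((N : ℝ) + 1 + s + t)))

/-- The quantity attached to one pseudo-ball in the definition of the class. The negative power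
of `ω` is taken in `[0,∞]`, so it is `∞` where `ω` vanishes. -/
def kQuantity {N : ℕ} (p s t q Q : ℝ) (ω : CSpace N → ℝ) (ζ : CSpace N) (R : ℝ) : ℝ≥0∞ :=
  (kFactor p s t q Q ζ R *
      ∫⁻ z in pseudoBall ζ R, ENNReal.ofReal (ω z) ∂(muMeasure N (Q + p * t))) *
  (kFactor p s t q Q ζ R *
      ∫⁻ z in pseudoBall ζ R, ENNReal.ofReal (ω z) ^ (-1 / (p - 1))
        ∂(muMeasure N (q + Real.conjExponent p * (s - q)))) ^ (p - 1)

/-- The class `K_p^{s,t,q,Q}`: the supremum over all pseudo-balls that reach the boundary is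
finite. As `d < 3` on the unit ball, radii are taken in `(0, 3]`: a pseudo-ball of radius larger
than `3` is the whole ball, which is already the pseudo-ball of radius `3`. -/
def MemK {N : ℕ} (p s t q Q : ℝ) (ω : CSpace N → ℝ) : Prop :=
  (⨆ (ζ : CSpace N) (R : ℝ) (_ : ζ ∈ unitBall N) (_ : 0 < R ∧ R ≤ 3)
      (_ : TouchesBoundary ζ R), kQuantity p s t q Q ω ζ R) < ∞

end

end BergmanBesov

/-! Write `α = N+1+s+t` and `b = (Q-q)/p`. For each pseudo-ball `B` of radius `R` touching the
sphere there is a compact companion `B'` in the open ball such that `1-⟨z,w⟩` stays close to one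
number `l` with positive real part, `|l| ≈ R`, for `z ∈ B`, `w ∈ B'` (`exists_companion`). There the
kernel has a nearly constant direction and size at least `k ≈ R^{-α}`, so integrals of non-negative
functions do not cancel.

Let `W`, `W'` be the `ω dμ_{Q+pt}`-masses of `B`, `B'`, and `G` the integral of `ω^{-1/(p-1)}` over
`B`. Testing the operator on a power of `1-|w|²` on `B'` gives `W (k m)^p ≤ C^p W'` with `m =
μ_{s+t+b}(B')`; testing on truncations of the extremal function on `B` gives `W' k^p G^{p-1} ≤ C^p`.
The unknown `W'` drops out (`IsOpBound.two_set_bound`): `(k² m)^p W G^{p-1} ≤ C^{2p}`. Since `m ≳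
R^{α+b}`, one has `k² m ≳ R^{b-α}`, which dominates the normalizing factor of the class
(`exists_kFactor_le`). -/

namespace BergmanBesov

variable {N : ℕ}

/-! ### Densities and weighted measures. -/

lemma one_sub_normSq_pos {z : CSpace N} (hz : z ∈ unitBall N) : 0 < 1 - ‖z‖ ^ 2 := by
  have h : ‖z‖ < 1 := by simpa [unitBall] using hz
  nlinarith [norm_nonneg z]

lemma measurableSet_unitBall : MeasurableSet (unitBall N) := measurableSet_ball

lemma ae_mem_unitBall : ∀ᵐ z ∂(ballMeasure N), z ∈ unitBall N :=
  Measure.ae_smul_measure (ae_restrict_mem measurableSet_unitBall) _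

lemma measurable_density (a : ℝ) :
    Measurable fun z : CSpace N => ENNReal.ofReal ((1 - ‖z‖ ^ 2) ^ a) := by
  fun_prop

lemma density_add {z : CSpace N} (hz : z ∈ unitBall N) (a b : ℝ) :
    ENNReal.ofReal ((1 - ‖z‖ ^ 2) ^ (a + b)) =
      ENNReal.ofReal ((1 - ‖z‖ ^ 2) ^ a) * ENNReal.ofReal ((1 - ‖z‖ ^ 2) ^ b) := by
  have h := one_sub_normSq_pos hz
  rw [Real.rpow_add h, ENNReal.ofReal_mul (Real.rpow_nonneg h.le _)]

lemma density_rpow {z : CSpace N} (hz : z ∈ unitBall N) (a : ℝ) {b : ℝ} (hb : 0 ≤ b) :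
    ENNReal.ofReal ((1 - ‖z‖ ^ 2) ^ a) ^ b = ENNReal.ofReal ((1 - ‖z‖ ^ 2) ^ (a * b)) := by
  have h := one_sub_normSq_pos hz
  rw [ENNReal.ofReal_rpow_of_nonneg (Real.rpow_nonneg h.le _) hb, ← Real.rpow_mul h.le]

lemma lintegral_muMeasure (a : ℝ) (φ : CSpace N → ℝ≥0∞) :
    ∫⁻ z, φ z ∂(muMeasure N a) =
      ∫⁻ z, ENNReal.ofReal ((1 - ‖z‖ ^ 2) ^ a) * φ z ∂(ballMeasure N) :=
  lintegral_withDensity_eq_lintegral_mul_non_measurable _ (measurable_density a)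
    (Filter.Eventually.of_forall fun _ => ENNReal.ofReal_lt_top) φ

lemma setLIntegral_muMeasure (a : ℝ) (φ : CSpace N → ℝ≥0∞) {S : Set (CSpace N)}
    (hS : MeasurableSet S) :
    ∫⁻ z in S, φ z ∂(muMeasure N a) =
      ∫⁻ z in S, ENNReal.ofReal ((1 - ‖z‖ ^ 2) ^ a) * φ z ∂(ballMeasure N) :=
  setLIntegral_withDensity_eq_setLIntegral_mul_non_measurable _ (measurable_density a) φ hS
    (Filter.Eventually.of_forall fun _ => ENNReal.ofReal_lt_top)

lemma IsWeight.aemeasurable {ω : CSpace N → ℝ} (hω : IsWeight ω) :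
    AEMeasurable (fun z => ENNReal.ofReal (ω z)) (ballMeasure N) :=
  (hω.locallyIntegrable.aestronglyMeasurable.aemeasurable.ennreal_ofReal).smul_measure _

lemma lintegral_weightedMeasure {ω : CSpace N → ℝ} (hω : IsWeight ω) (a : ℝ)
    (φ : CSpace N → ℝ≥0∞) :
    ∫⁻ z, φ z ∂(weightedMeasure ω a) =
      ∫⁻ z, ENNReal.ofReal ((1 - ‖z‖ ^ 2) ^ a) * (ENNReal.ofReal (ω z) * φ z)
        ∂(ballMeasure N) := by
  rw [weightedMeasure, lintegral_withDensity_eq_lintegral_mul_non_measurable₀ (muMeasure N a)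
    (hω.aemeasurable.mono_ac (withDensity_absolutelyContinuous _ _))
    (Filter.Eventually.of_forall fun _ => ENNReal.ofReal_lt_top), lintegral_muMeasure]
  rfl

lemma weightedMeasure_absolutelyContinuous (ω : CSpace N → ℝ) (a : ℝ) :
    weightedMeasure ω a ≪ ballMeasure N :=
  (withDensity_absolutelyContinuous _ _).trans (withDensity_absolutelyContinuous _ _)

/-! ### Testing the operator. -/

lemma lintegral_rpow_le_of_eLpNorm_le {α E F : Type*} [MeasurableSpace α] [NormedAddCommGroup E]
    [NormedAddCommGroup F] {μ ν : Measure α} {p C : ℝ} (hp : 0 < p) {g : α → E} {f : α → F}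
    (h : eLpNorm g (ENNReal.ofReal p) μ ≤ ENNReal.ofReal C * eLpNorm f (ENNReal.ofReal p) ν) :
    ∫⁻ x, ‖g x‖ₑ ^ p ∂μ ≤ ENNReal.ofReal C ^ p * ∫⁻ x, ‖f x‖ₑ ^ p ∂ν := by
  have h0 : ENNReal.ofReal p ≠ 0 := by simpa using hp
  rw [eLpNorm_eq_lintegral_rpow_enorm_toReal h0 ENNReal.ofReal_ne_top,
    eLpNorm_eq_lintegral_rpow_enorm_toReal h0 ENNReal.ofReal_ne_top,
    ENNReal.toReal_ofReal hp.le] at h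
  have h' := ENNReal.rpow_le_rpow h hp.le
  rwa [ENNReal.mul_rpow_of_nonneg _ _ hp.le, ← ENNReal.rpow_mul, ← ENNReal.rpow_mul,
    one_div_mul_cancel hp.ne', ENNReal.rpow_one, ENNReal.rpow_one] at h'

/-- If the kernel points in a fixed direction on `A × supp f`, then the operator cannot be small
on `A`. -/
lemma le_enorm_integral_opIntegrand {s t q k : ℝ} {u : ℂ} (hk : 0 ≤ k) (hu : ‖u‖ ≤ 1)
    {f : CSpace N → ℝ} (hf : ∀ w, 0 ≤ f w) {z : CSpace N}
    (hK : ∀ w ∈ unitBall N, f w ≠ 0 → k ≤ (kernel (s + t) z w * u).re)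
    (hint : Integrable (opIntegrand s t q (fun w => (f w : ℂ)) z) (muMeasure N q)) :
    ENNReal.ofReal k * ∫⁻ w, ENNReal.ofReal ((1 - ‖w‖ ^ 2) ^ s) * ENNReal.ofReal (f w)
        ∂(ballMeasure N) ≤
      ‖∫ w, opIntegrand s t q (fun w => (f w : ℂ)) z w ∂(muMeasure N q)‖ₑ := by
  set J := ∫ w, opIntegrand s t q (fun w => (f w : ℂ)) z w ∂(muMeasure N q)
  have hmem : ∀ᵐ w ∂(muMeasure N q), w ∈ unitBall N :=
    (withDensity_absolutelyContinuous _ _).ae_le ae_mem_unitBall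
  -- After multiplication by `u` the integrand has non-negative real part, so `‖J‖ ≥ Re (J u)`
  -- involves no cancellation.
  have hre : ∀ w ∈ unitBall N, k * ((1 - ‖w‖ ^ 2) ^ (s - q) * f w) ≤
      (opIntegrand s t q (fun w => (f w : ℂ)) z w * u).re := by
    intro w hw
    have e : opIntegrand s t q (fun w => (f w : ℂ)) z w * u =
        (((1 - ‖w‖ ^ 2) ^ (s - q) * f w : ℝ) : ℂ) * (kernel (s + t) z w * u) := by
      simp only [opIntegrand]; push_cast; ring
    rw [e, Complex.re_ofReal_mul]
    have h0 : 0 ≤ (1 - ‖w‖ ^ 2) ^ (s - q) * f w :=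
      mul_nonneg (Real.rpow_nonneg (one_sub_normSq_pos hw).le _) (hf w)
    rcases eq_or_ne (f w) 0 with h | h
    · simp [h]
    · rw [mul_comm]
      exact mul_le_mul_of_nonneg_left (hK w hw h) h0
  have hre0 : ∀ w ∈ unitBall N, 0 ≤ k * ((1 - ‖w‖ ^ 2) ^ (s - q) * f w) := fun w hw =>
    mul_nonneg hk (mul_nonneg (Real.rpow_nonneg (one_sub_normSq_pos hw).le _) (hf w))
  have hintu : Integrable (fun w => (opIntegrand s t q (fun w => (f w : ℂ)) z w * u).re)
      (muMeasure N q) := (hint.mul_const u).re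
  calc _ = ENNReal.ofReal k * ∫⁻ w, ENNReal.ofReal ((1 - ‖w‖ ^ 2) ^ (s - q) * f w)
        ∂(muMeasure N q) := by
        rw [lintegral_muMeasure]
        congr 1
        refine lintegral_congr_ae ?_
        filter_upwards [ae_mem_unitBall] with w hw
        rw [ENNReal.ofReal_mul (Real.rpow_nonneg (one_sub_normSq_pos hw).le _), ← mul_assoc,
          ← density_add hw]
        ring_nf
    _ = ∫⁻ w, ENNReal.ofReal (k * ((1 - ‖w‖ ^ 2) ^ (s - q) * f w)) ∂(muMeasure N q) := by
        rw [← lintegral_const_mul' _ _ ENNReal.ofReal_ne_top]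
        simp_rw [ENNReal.ofReal_mul hk]
    _ ≤ ∫⁻ w, ENNReal.ofReal (opIntegrand s t q (fun w => (f w : ℂ)) z w * u).re
          ∂(muMeasure N q) := by
        refine lintegral_mono_ae ?_
        filter_upwards [hmem] with w hw
        exact ENNReal.ofReal_le_ofReal (hre w hw)
    _ = ENNReal.ofReal (∫ w, (opIntegrand s t q (fun w => (f w : ℂ)) z w * u).re
          ∂(muMeasure N q)) := by
        rw [ofReal_integral_eq_lintegral_ofReal hintu]
        filter_upwards [hmem] with w hw
        exact (hre0 w hw).trans (hre w hw)
    _ = ENNReal.ofReal (J * u).re := by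
        congr 1
        have := integral_re (hint.mul_const u)
        simp only [RCLike.re_to_complex] at this
        rw [this, integral_mul_const]
    _ ≤ ENNReal.ofReal ‖J‖ := by
        refine ENNReal.ofReal_le_ofReal ((Complex.re_le_norm _).trans ?_)
        rw [norm_mul]
        exact mul_le_of_le_one_right (norm_nonneg _) hu
    _ = ‖J‖ₑ := ofReal_norm J

/-- The constant `C` bounds the operator on `L^p(ω dμ_q)`. -/
def IsOpBound (p s t q Q C : ℝ) (ω : CSpace N → ℝ) : Prop :=
  ∀ f : CSpace N → ℂ, MemLp f (ENNReal.ofReal p) (weightedMeasure ω q) →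
    (∀ᵐ z ∂(ballMeasure N), Integrable (opIntegrand s t q f z) (muMeasure N q)) ∧
    MemLp (opP s t q f) (ENNReal.ofReal p) (weightedMeasure ω Q) ∧
    eLpNorm (opP s t q f) (ENNReal.ofReal p) (weightedMeasure ω Q) ≤
      ENNReal.ofReal C * eLpNorm f (ENNReal.ofReal p) (weightedMeasure ω q)

/-- Testing the boundedness of the operator on a non-negative function. -/
lemma IsOpBound.testing {p s t q Q C k : ℝ} (hp : 1 < p) {ω : CSpace N → ℝ}
    (hω : IsWeight ω) (hC : IsOpBound p s t q Q C ω) {u : ℂ} (hk : 0 ≤ k) (hu : ‖u‖ ≤ 1)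
    {f : CSpace N → ℝ} (hf : ∀ w, 0 ≤ f w) (hfm : AEMeasurable f (ballMeasure N))
    {A : Set (CSpace N)} (hA : MeasurableSet A)
    (hK : ∀ z ∈ A, ∀ w ∈ unitBall N, f w ≠ 0 → k ≤ (kernel (s + t) z w * u).re)
    (hfin : ∫⁻ w, ENNReal.ofReal ((1 - ‖w‖ ^ 2) ^ q) *
      (ENNReal.ofReal (ω w) * ENNReal.ofReal (f w) ^ p) ∂(ballMeasure N) ≠ ∞) :
    (∫⁻ z in A, ENNReal.ofReal (ω z) ∂(muMeasure N (Q + p * t))) *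
        (ENNReal.ofReal k * ∫⁻ w, ENNReal.ofReal ((1 - ‖w‖ ^ 2) ^ s) * ENNReal.ofReal (f w)
          ∂(ballMeasure N)) ^ p ≤
      ENNReal.ofReal C ^ p * ∫⁻ w, ENNReal.ofReal ((1 - ‖w‖ ^ 2) ^ q) *
        (ENNReal.ofReal (ω w) * ENNReal.ofReal (f w) ^ p) ∂(ballMeasure N) := by
  have hp0 : 0 < p := by linarith
  have hnorm : ∫⁻ w, ‖((f w : ℝ) : ℂ)‖ₑ ^ p ∂(weightedMeasure ω q) =
      ∫⁻ w, ENNReal.ofReal ((1 - ‖w‖ ^ 2) ^ q) *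
      (ENNReal.ofReal (ω w) * ENNReal.ofReal (f w) ^ p) ∂(ballMeasure N) := by
    rw [lintegral_weightedMeasure hω]
    refine lintegral_congr fun w => ?_
    rw [← ofReal_norm, Complex.norm_real, Real.norm_of_nonneg (hf w)]
  have hmem : MemLp (fun w => (f w : ℂ)) (ENNReal.ofReal p) (weightedMeasure ω q) := by
    refine ⟨((Complex.measurable_ofReal.comp_aemeasurable hfm).mono_ac
      (weightedMeasure_absolutelyContinuous ω q)).aestronglyMeasurable, ?_⟩
    rw [eLpNorm_eq_lintegral_rpow_enorm_toReal (by simpa using hp0) ENNReal.ofReal_ne_top,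
      ENNReal.toReal_ofReal hp0.le, hnorm]
    exact ENNReal.rpow_lt_top_of_nonneg (by positivity) hfin
  obtain ⟨hint, -, hle⟩ := hC _ hmem
  have hle' := lintegral_rpow_le_of_eLpNorm_le hp0 hle
  rw [hnorm] at hle'
  refine le_trans ?_ hle'
  set L := ENNReal.ofReal k * ∫⁻ w, ENNReal.ofReal ((1 - ‖w‖ ^ 2) ^ s) * ENNReal.ofReal (f w)
          ∂(ballMeasure N) with hL
  rw [lintegral_weightedMeasure hω, setLIntegral_muMeasure _ _ hA, mul_comm]
  refine (lintegral_const_mul_le _ _).trans ?_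
  refine le_trans (lintegral_mono_ae ?_) (setLIntegral_le_lintegral A _)
  filter_upwards [ae_restrict_mem hA, ae_restrict_of_ae hint, ae_restrict_of_ae ae_mem_unitBall]
    with z hzA hz hzb
  have key := le_enorm_integral_opIntegrand hk hu hf (hK z hzA) hz
  rw [← hL] at key
  have hP : ‖opP s t q (fun w => (f w : ℂ)) z‖ₑ ^ p =
      ENNReal.ofReal ((1 - ‖z‖ ^ 2) ^ (p * t)) *
        ‖∫ w, opIntegrand s t q (fun w => (f w : ℂ)) z w ∂(muMeasure N q)‖ₑ ^ p := by
    rw [opP, enorm_mul, ENNReal.mul_rpow_of_nonneg _ _ hp0.le, mul_comm p t,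
      ← density_rpow hzb t hp0.le, ← ofReal_norm (((1 - ‖z‖ ^ 2) ^ t : ℝ) : ℂ),
      Complex.norm_real,
      Real.norm_of_nonneg (Real.rpow_nonneg (one_sub_normSq_pos hzb).le _)]
  rw [hP, density_add hzb]
  calc _ = ENNReal.ofReal ((1 - ‖z‖ ^ 2) ^ Q) * (ENNReal.ofReal (ω z) *
        (ENNReal.ofReal ((1 - ‖z‖ ^ 2) ^ (p * t)) * L ^ p)) := by ring
    _ ≤ _ := by gcongr

/-- Testing on powers of `1 - |w|²` supported in a set `B`. -/
lemma IsOpBound.testing_indicator {p s t q Q C k : ℝ} (hp : 1 < p) {ω : CSpace N → ℝ}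
    (hω : IsWeight ω) (hC : IsOpBound p s t q Q C ω) {u : ℂ} (hk : 0 ≤ k) (hu : ‖u‖ ≤ 1)
    {A B : Set (CSpace N)} (hA : MeasurableSet A) (hB : MeasurableSet B)
    (hK : ∀ z ∈ A, ∀ w ∈ B, k ≤ (kernel (s + t) z w * u).re)
    (hfin : ∫⁻ w in B, ENNReal.ofReal (ω w) ∂(muMeasure N (Q + p * t)) ≠ ∞) :
    (∫⁻ z in A, ENNReal.ofReal (ω z) ∂(muMeasure N (Q + p * t))) *
        (ENNReal.ofReal k * muMeasure N (s + t + (Q - q) / p) B) ^ p ≤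
      ENNReal.ofReal C ^ p * ∫⁻ w in B, ENNReal.ofReal (ω w) ∂(muMeasure N (Q + p * t)) := by
  have hp0 : 0 < p := by linarith
  -- This exponent satisfies `q + c p = Q + p t`, so the `p`-th power of the norm of `f` is exactly
  -- the mass of `B` on the right-hand side.
  set c := t + (Q - q) / p with hc
  set f : CSpace N → ℝ := (unitBall N ∩ B).indicator fun w => (1 - ‖w‖ ^ 2) ^ c with hfdef
  have hf : ∀ w, 0 ≤ f w := fun w => Set.indicator_nonneg
    (fun w hw => Real.rpow_nonneg (one_sub_normSq_pos hw.1).le _) w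
  have hfm : Measurable f := by
    refine Measurable.indicator ?_ (measurableSet_unitBall.inter hB)
    fun_prop
  have e1 : ∫⁻ w, ENNReal.ofReal ((1 - ‖w‖ ^ 2) ^ q) *
      (ENNReal.ofReal (ω w) * ENNReal.ofReal (f w) ^ p) ∂(ballMeasure N) =
      ∫⁻ w in B, ENNReal.ofReal (ω w) ∂(muMeasure N (Q + p * t)) := by
    rw [setLIntegral_muMeasure _ _ hB, ← lintegral_indicator hB]
    refine lintegral_congr_ae ?_
    filter_upwards [ae_mem_unitBall] with w hw
    by_cases hwB : w ∈ B
    · have h1 : f w = (1 - ‖w‖ ^ 2) ^ c := Set.indicator_of_mem (Set.mem_inter hw hwB) _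
      rw [h1, density_rpow hw _ hp0.le, Set.indicator_of_mem hwB,
        show Q + p * t = q + c * p by rw [hc]; field_simp; ring, density_add hw]
      ring
    · have h1 : f w = 0 := Set.indicator_of_notMem (fun h => hwB h.2) _
      simp [h1, hwB, hp0]
  have e2 : ∫⁻ w, ENNReal.ofReal ((1 - ‖w‖ ^ 2) ^ s) * ENNReal.ofReal (f w)
      ∂(ballMeasure N) = muMeasure N (s + t + (Q - q) / p) B := by
    rw [muMeasure, withDensity_apply _ hB, ← lintegral_indicator hB]
    refine lintegral_congr_ae ?_
    filter_upwards [ae_mem_unitBall] with w hw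
    by_cases hwB : w ∈ B
    · have h1 : f w = (1 - ‖w‖ ^ 2) ^ c := Set.indicator_of_mem (Set.mem_inter hw hwB) _
      rw [h1, Set.indicator_of_mem hwB, ← density_add hw, hc, add_assoc]
    · have h1 : f w = 0 := Set.indicator_of_notMem (fun h => hwB h.2) _
      simp [h1, hwB]
  have := hC.testing hp hω hk hu hf hfm.aemeasurable hA
    (fun z hz w _ hw => hK z hz w (by
      by_contra hwB
      exact hw (Set.indicator_of_notMem (fun h => hwB h.2) _))) (by rwa [e1])
  rwa [e1, e2] at this

/-- Duality: testing on truncations of the extremal function. -/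
lemma IsOpBound.testing_dual {p s t q Q C k : ℝ} (hp : 1 < p) {ω : CSpace N → ℝ}
    (hω : IsWeight ω) (hC : IsOpBound p s t q Q C ω) {u : ℂ} (hk : 0 ≤ k) (hu : ‖u‖ ≤ 1)
    {A B : Set (CSpace N)} (hA : MeasurableSet A) (hB : MeasurableSet B)
    (hK : ∀ z ∈ A, ∀ w ∈ B, k ≤ (kernel (s + t) z w * u).re) :
    (∫⁻ z in A, ENNReal.ofReal (ω z) ∂(muMeasure N (Q + p * t))) * ENNReal.ofReal k ^ p *
        (∫⁻ w in B, ENNReal.ofReal (ω w) ^ (-1 / (p - 1))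
          ∂(muMeasure N (q + Real.conjExponent p * (s - q)))) ^ (p - 1) ≤
      ENNReal.ofReal C ^ p := by
  have hp0 : 0 < p := by linarith
  have hp1 : 0 < p - 1 := by linarith
  set e := q + Real.conjExponent p * (s - q) with he
  -- With this balance of exponents, `f = F (1-|w|²)^{-s}` makes `ω f^p dμ_q` and `f dμ_s` both at
  -- most `F dμ`.
  have hexp : q + e * (p - 1) + -s * p = 0 := by
    rw [he, Real.conjExponent]; field_simp; ring
  set M := ∫⁻ z in A, ENNReal.ofReal (ω z) ∂(muMeasure N (Q + p * t)) with hM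
  set F : CSpace N → ℝ≥0∞ := fun w =>
    ENNReal.ofReal ((1 - ‖w‖ ^ 2) ^ e) * ENNReal.ofReal (ω w) ^ (-1 / (p - 1)) with hF
  have hFm : AEMeasurable F (ballMeasure N) :=
    (measurable_density e).aemeasurable.mul (hω.aemeasurable.pow_const _)
  have hFnm : ∀ n : ℕ, AEMeasurable (fun w => min (F w) n) (ballMeasure N) := fun n =>
    hFm.min aemeasurable_const
  have hFω : ∀ w ∈ unitBall N, ∀ n : ℕ, ENNReal.ofReal (ω w) * min (F w) n ^ (p - 1) ≤
      ENNReal.ofReal ((1 - ‖w‖ ^ 2) ^ (e * (p - 1))) := by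
    intro w hw n
    -- Where `ω` vanishes `F` is infinite, but the truncation is finite and the left side is `0`.
    rcases eq_or_ne (ENNReal.ofReal (ω w)) 0 with h0 | h0
    · simp [h0]
    calc _ ≤ ENNReal.ofReal (ω w) * F w ^ (p - 1) := by
          gcongr
          exact min_le_left _ _
      _ = ENNReal.ofReal ((1 - ‖w‖ ^ 2) ^ (e * (p - 1))) *
          (ENNReal.ofReal (ω w) * (ENNReal.ofReal (ω w))⁻¹) := by
          rw [hF, ENNReal.mul_rpow_of_nonneg _ _ hp1.le, density_rpow hw _ hp1.le,
            ← ENNReal.rpow_mul, div_mul_cancel₀ _ hp1.ne', ENNReal.rpow_neg_one]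
          ring
      _ = _ := by rw [ENNReal.mul_inv_cancel h0 ENNReal.ofReal_ne_top, mul_one]
  have main : ∀ n : ℕ, M * ENNReal.ofReal k ^ p *
      (∫⁻ w in B, min (F w) n ∂(ballMeasure N)) ^ (p - 1) ≤ ENNReal.ofReal C ^ p := by
    intro n
    set L := ∫⁻ w in B, min (F w) n ∂(ballMeasure N) with hL
    -- The truncation is bounded and the measure has mass at most one; finiteness makes `f`
    -- admissible and allows division by `L` below.
    have hLfin : L ≠ ∞ := by
      refine ne_top_of_le_ne_top ?_ (lintegral_mono fun w => min_le_right (F w) (n : ℝ≥0∞))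
      rw [lintegral_const]
      refine ENNReal.mul_ne_top (ENNReal.natCast_ne_top n)
        (ne_top_of_le_ne_top ENNReal.one_ne_top ?_)
      rw [Measure.restrict_apply_univ]
      refine (measure_mono (Set.subset_univ _)).trans ?_
      simp only [ballMeasure, Measure.smul_apply, Measure.restrict_apply_univ, smul_eq_mul]
      exact ENNReal.inv_mul_le_one _
    set f : CSpace N → ℝ := (unitBall N ∩ B).indicator
      fun w => (min (F w) n).toReal * (1 - ‖w‖ ^ 2) ^ (-s) with hfdef
    have hf : ∀ w, 0 ≤ f w := fun w => Set.indicator_nonneg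
      (fun w hw => mul_nonneg ENNReal.toReal_nonneg
        (Real.rpow_nonneg (one_sub_normSq_pos hw.1).le _)) w
    have hfm : AEMeasurable f (ballMeasure N) := by
      refine AEMeasurable.indicator ((hFnm n).ennreal_toReal.mul ?_)
        (measurableSet_unitBall.inter hB)
      fun_prop
    have hfB : ∀ w ∈ unitBall N, w ∈ B →
        ENNReal.ofReal (f w) = min (F w) n * ENNReal.ofReal ((1 - ‖w‖ ^ 2) ^ (-s)) := by
      intro w hw hwB
      have h1 : f w = (min (F w) n).toReal * (1 - ‖w‖ ^ 2) ^ (-s) :=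
        Set.indicator_of_mem (Set.mem_inter hw hwB) _
      rw [h1, ENNReal.ofReal_mul ENNReal.toReal_nonneg, ENNReal.ofReal_toReal
        (ne_top_of_le_ne_top (ENNReal.natCast_ne_top n) (min_le_right _ _))]
    have hfB' : ∀ w, w ∉ B → f w = 0 := fun w hw =>
      Set.indicator_of_notMem (fun h => hw h.2) _
    have e1 : ∫⁻ w, ENNReal.ofReal ((1 - ‖w‖ ^ 2) ^ q) *
        (ENNReal.ofReal (ω w) * ENNReal.ofReal (f w) ^ p) ∂(ballMeasure N) ≤ L := by
      rw [hL, ← lintegral_indicator hB]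
      refine lintegral_mono_ae ?_
      filter_upwards [ae_mem_unitBall] with w hw
      by_cases hwB : w ∈ B
      · rw [hfB w hw hwB, Set.indicator_of_mem hwB, ENNReal.mul_rpow_of_nonneg _ _ hp0.le,
          density_rpow hw _ hp0.le]
        have hpow : min (F w) n ^ p = min (F w) n ^ (p - 1) * min (F w) n := by
          conv_lhs => rw [← sub_add_cancel p 1]
          rw [ENNReal.rpow_add_of_nonneg _ _ hp1.le zero_le_one, ENNReal.rpow_one]
        calc _ = ENNReal.ofReal ((1 - ‖w‖ ^ 2) ^ q) *
              (ENNReal.ofReal (ω w) * min (F w) n ^ (p - 1)) *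
              ENNReal.ofReal ((1 - ‖w‖ ^ 2) ^ (-s * p)) * min (F w) n := by
              rw [hpow]; ring
          _ ≤ ENNReal.ofReal ((1 - ‖w‖ ^ 2) ^ q) *
              ENNReal.ofReal ((1 - ‖w‖ ^ 2) ^ (e * (p - 1))) *
              ENNReal.ofReal ((1 - ‖w‖ ^ 2) ^ (-s * p)) * min (F w) n := by
              gcongr
              exact hFω w hw n
          _ = min (F w) n := by
              rw [← density_add hw, ← density_add hw, hexp]
              simp
      · simp [hfB' w hwB, hwB, hp0]
    have e2 : ∫⁻ w, ENNReal.ofReal ((1 - ‖w‖ ^ 2) ^ s) * ENNReal.ofReal (f w)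
        ∂(ballMeasure N) = L := by
      rw [hL, ← lintegral_indicator hB]
      refine lintegral_congr_ae ?_
      filter_upwards [ae_mem_unitBall] with w hw
      by_cases hwB : w ∈ B
      · rw [hfB w hw hwB, Set.indicator_of_mem hwB, mul_left_comm, ← density_add hw]
        simp
      · simp [hfB' w hwB, hwB]
    have key := hC.testing hp hω hk hu hf hfm hA
      (fun z hz w _ hw => hK z hz w (by
        by_contra hwB
        exact hw (hfB' w hwB))) (ne_top_of_le_ne_top hLfin e1)
    rw [e2, ← hM] at key
    rcases eq_or_ne L 0 with h0 | h0
    · rw [h0, ENNReal.zero_rpow_of_pos hp1]; simp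
    have hpow : L ^ p = L ^ (p - 1) * L := by
      conv_lhs => rw [← sub_add_cancel p 1]
      rw [ENNReal.rpow_add_of_nonneg _ _ hp1.le zero_le_one, ENNReal.rpow_one]
    -- The test reads `M (k L)^p ≤ C^p L`; one factor `L` is cancelled.
    have key' : M * ENNReal.ofReal k ^ p * L ^ (p - 1) * L ≤ ENNReal.ofReal C ^ p * L := by
      calc _ = M * (ENNReal.ofReal k * L) ^ p := by
            rw [ENNReal.mul_rpow_of_nonneg _ _ hp0.le, hpow]; ring
        _ ≤ _ := key.trans (by gcongr)
    exact (ENNReal.mul_le_mul_iff_left h0 hLfin).mp key'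
  -- Monotone convergence removes the truncation.
  have hsup : ∫⁻ w in B, ENNReal.ofReal (ω w) ^ (-1 / (p - 1)) ∂(muMeasure N e) =
      ⨆ n : ℕ, ∫⁻ w in B, min (F w) n ∂(ballMeasure N) := by
    rw [setLIntegral_muMeasure _ _ hB, ← lintegral_iSup' (fun n => (hFnm n).restrict)
      (Filter.Eventually.of_forall fun w m n hmn => by
        dsimp only; gcongr)]
    refine lintegral_congr fun w => ?_
    change F w = _
    rw [← inf_iSup_eq, ENNReal.iSup_natCast, inf_top_eq]
  rw [hsup, ← ENNReal.orderIsoRpow_apply (p - 1) hp1, OrderIso.map_iSup, ENNReal.mul_iSup]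
  exact iSup_le fun n => by simpa using main n

/-- Combining the two tests for a pair of sets on which the kernel has a constant direction. -/
lemma IsOpBound.two_set_bound {p s t q Q C k : ℝ} (hp : 1 < p) {ω : CSpace N → ℝ}
    (hω : IsWeight ω) (hC : IsOpBound p s t q Q C ω) {u v : ℂ} (hk : 0 ≤ k) (hu : ‖u‖ ≤ 1)
    (hv : ‖v‖ ≤ 1) {B B' : Set (CSpace N)} (hB : MeasurableSet B) (hB' : MeasurableSet B')
    (hK : ∀ z ∈ B, ∀ w ∈ B', k ≤ (kernel (s + t) z w * u).re)
    (hK' : ∀ z ∈ B', ∀ w ∈ B, k ≤ (kernel (s + t) z w * v).re)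
    (hfin : ∫⁻ w in B', ENNReal.ofReal (ω w) ∂(muMeasure N (Q + p * t)) ≠ ∞) :
    (ENNReal.ofReal k ^ 2 * muMeasure N (s + t + (Q - q) / p) B') ^ p *
      ((∫⁻ z in B, ENNReal.ofReal (ω z) ∂(muMeasure N (Q + p * t))) *
        (∫⁻ w in B, ENNReal.ofReal (ω w) ^ (-1 / (p - 1))
          ∂(muMeasure N (q + Real.conjExponent p * (s - q)))) ^ (p - 1)) ≤
      (ENNReal.ofReal C ^ p) ^ 2 := by
  have hp0 : 0 ≤ p := by linarith
  have h1 := hC.testing_indicator hp hω hk hu hB hB' hK hfin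
  have h2 := hC.testing_dual hp hω hk hv hB' hB hK'
  set W := ∫⁻ z in B, ENNReal.ofReal (ω z) ∂(muMeasure N (Q + p * t))
  set W' := ∫⁻ w in B', ENNReal.ofReal (ω w) ∂(muMeasure N (Q + p * t))
  set G := (∫⁻ w in B, ENNReal.ofReal (ω w) ^ (-1 / (p - 1))
          ∂(muMeasure N (q + Real.conjExponent p * (s - q)))) ^ (p - 1)
  set m := muMeasure N (s + t + (Q - q) / p) B'
  calc _ = W * (ENNReal.ofReal k * m) ^ p * (ENNReal.ofReal k ^ p * G) := by
        rw [sq, mul_assoc (ENNReal.ofReal k), ENNReal.mul_rpow_of_nonneg _ _ hp0]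
        ring
    -- The two tests are chained rather than divided, so `W' = 0` needs no separate treatment.
    _ ≤ ENNReal.ofReal C ^ p * W' * (ENNReal.ofReal k ^ p * G) := by gcongr
    _ = ENNReal.ofReal C ^ p * (W' * ENNReal.ofReal k ^ p * G) := by ring
    _ ≤ _ := by rw [sq]; gcongr

/-- The power of `1-|w|²` is bounded on a compact subset of the open ball, whatever its sign. This
makes the test function on the companion set admissible. -/
lemma IsWeight.lintegral_compact_ne_top {ω : CSpace N → ℝ} (hω : IsWeight ω) (a : ℝ)
    {S : Set (CSpace N)} (hS : IsCompact S) (hSb : S ⊆ unitBall N) :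
    ∫⁻ w in S, ENNReal.ofReal (ω w) ∂(muMeasure N a) ≠ ∞ := by
  have hcont : ContinuousOn (fun w : CSpace N => (1 - ‖w‖ ^ 2) ^ a) S := by
    refine ContinuousOn.rpow_const (by fun_prop) fun w hw => Or.inl ?_
    exact (one_sub_normSq_pos (hSb hw)).ne'
  obtain ⟨D, hD⟩ := hS.bddAbove_image hcont
  have hint : ∫⁻ w in S, ENNReal.ofReal (ω w) ∂(ballMeasure N) ≠ ∞ := by
    have h1 := (hω.locallyIntegrable.integrableOn_compact_subset hSb hS).lintegral_lt_top
    rw [ballMeasure, Measure.restrict_smul, lintegral_smul_measure]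
    refine ENNReal.mul_ne_top (ENNReal.inv_ne_top.mpr ?_) ?_
    · exact (Metric.isOpen_ball.measure_pos _ ⟨0, by simp⟩).ne'
    · refine ne_top_of_le_ne_top h1.ne ?_
      exact lintegral_mono' (Measure.restrict_mono le_rfl Measure.restrict_le_self) le_rfl
  rw [setLIntegral_muMeasure _ _ hS.measurableSet]
  refine ne_top_of_le_ne_top (ENNReal.mul_ne_top (ENNReal.ofReal_ne_top (r := D)) hint) ?_
  rw [← lintegral_const_mul' _ _ ENNReal.ofReal_ne_top]
  refine setLIntegral_mono' hS.measurableSet fun w hw => ?_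
  gcongr
  exact hD ⟨w, hw, rfl⟩

/-! ### The Hermitian product and the direction of the kernel. -/

lemma herm_conj (z w : CSpace N) : (starRingEnd ℂ) (herm z w) = herm w z :=
  inner_conj_symm z w

lemma norm_herm_le (z w : CSpace N) : ‖herm z w‖ ≤ ‖z‖ * ‖w‖ := by
  rw [mul_comm]; exact norm_inner_le_norm w z

lemma herm_add_left (x y w : CSpace N) : herm (x + y) w = herm x w + herm y w :=
  inner_add_right _ _ _

lemma herm_sub_left (x y w : CSpace N) : herm (x - y) w = herm x w - herm y w :=
  inner_sub_right _ _ _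

lemma herm_sub_right (x y w : CSpace N) : herm w (x - y) = herm w x - herm w y :=
  inner_sub_left _ _ _

lemma herm_smul_left (c : ℂ) (x w : CSpace N) : herm (c • x) w = c * herm x w :=
  inner_smul_right _ _ _

lemma herm_smul_right (c : ℂ) (x w : CSpace N) :
    herm w (c • x) = (starRingEnd ℂ) c * herm w x :=
  inner_smul_left _ _ _

lemma herm_self_of_unit {η : CSpace N} (hη : ‖η‖ = 1) : herm η η = 1 := by
  simp [herm, inner_self_eq_norm_sq_to_K, hη]

lemma continuous_herm_left (w : CSpace N) : Continuous fun z => herm z w := by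
  unfold herm; fun_prop

lemma norm_sq_eq_herm_add {η : CSpace N} (hη : ‖η‖ = 1) (z : CSpace N) :
    ‖z‖ ^ 2 = ‖herm z η‖ ^ 2 + ‖z - herm z η • η‖ ^ 2 := by
  have h0 : inner ℂ (herm z η • η) (z - herm z η • η) = 0 := by
    change herm (z - herm z η • η) (herm z η • η) = 0
    rw [herm_smul_right, herm_sub_left, herm_smul_left, herm_self_of_unit hη]
    ring
  have h := norm_add_sq_eq_norm_sq_add_norm_sq_of_inner_eq_zero _ _ h0
  rw [add_sub_cancel, norm_smul, hη, mul_one] at h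
  nlinarith [h]

lemma one_sub_herm_re_pos {z w : CSpace N} (hz : z ∈ unitBall N) (hw : w ∈ unitBall N) :
    0 < (1 - herm z w).re := by
  have hz' : ‖z‖ < 1 := by simpa [unitBall] using hz
  have hw' : ‖w‖ < 1 := by simpa [unitBall] using hw
  have h1 : ‖herm z w‖ < 1 := (norm_herm_le z w).trans_lt
    (mul_lt_one_of_nonneg_of_lt_one_left (norm_nonneg _) hz' hw'.le)
  have h2 := Complex.re_le_norm (herm z w)
  simp only [Complex.sub_re, Complex.one_re]
  linarith

lemma kernel_eq {a : ℝ} (ha : -((N : ℝ) + 1) < a) (z w : CSpace N) :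
    kernel a z w = 1 / (1 - herm z w) ^ (((N : ℝ) + 1 + a : ℝ) : ℂ) := by
  rw [kernel, if_pos ha]

/-- `1-⟨z,w⟩` lies in the right half-plane, off the branch cut, so conjugation commutes with the
power. A direction estimate on `B × B'` thus transfers to `B' × B`. -/
lemma kernel_conj {a : ℝ} (ha : -((N : ℝ) + 1) < a) {z w : CSpace N}
    (hz : z ∈ unitBall N) (hw : w ∈ unitBall N) :
    kernel a w z = (starRingEnd ℂ) (kernel a z w) := by
  have h := one_sub_herm_re_pos hz hw
  have harg : (1 - herm z w).arg ≠ Real.pi := by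
    have := Complex.abs_arg_lt_pi_div_two_iff.mpr (Or.inl h)
    intro h'
    rw [h', abs_of_pos Real.pi_pos] at this
    linarith [Real.pi_pos]
  rw [kernel_eq ha, kernel_eq ha, ← herm_conj z w, map_div₀, map_one]
  have := Complex.conj_cpow (1 - herm z w) (((N : ℝ) + 1 + a : ℝ) : ℂ) harg
  rw [Complex.conj_ofReal] at this
  rw [← this, map_sub, map_one]

/-- Continuity at `y = 1`. The bound `ε ≤ 1/2` keeps `y` in the right half-plane. -/
lemma exists_half_le_re_inv_cpow (α : ℝ) :
    ∃ ε : ℝ, 0 < ε ∧ ε ≤ 1 / 2 ∧ ∀ y : ℂ, ‖y - 1‖ < ε → 1 / 2 ≤ (1 / y ^ (α : ℂ)).re := by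
  have hc : ContinuousAt (fun y : ℂ => (1 / y ^ (α : ℂ)).re) 1 := by
    refine Complex.continuous_re.continuousAt.comp ?_
    refine ContinuousAt.div continuousAt_const ?_ (by simp)
    exact continuousAt_id.cpow continuousAt_const (by simp [Complex.slitPlane])
  have h1 : (1 / 2 : ℝ) < (1 / (1 : ℂ) ^ (α : ℂ)).re := by norm_num
  have := hc.eventually (lt_mem_nhds h1)
  obtain ⟨ε, hε, h⟩ := Metric.eventually_nhds_iff.mp this
  refine ⟨min ε (1 / 2), by positivity, min_le_right _ _, fun y hy => (h ?_).le⟩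
  rw [dist_eq_norm]
  exact hy.trans_le (min_le_left _ _)

/-- Where `1 - ⟨z,w⟩` is close to `l`, the kernel points in a fixed direction. -/
lemma kernel_direction {a ε : ℝ} (ha : -((N : ℝ) + 1) < a) (hε2 : ε ≤ 1 / 2)
    (hε : ∀ y : ℂ, ‖y - 1‖ < ε → 1 / 2 ≤ (1 / y ^ (((N : ℝ) + 1 + a : ℝ) : ℂ)).re)
    {l : ℂ} (hl : 0 < l.re) {z w : CSpace N} (h : ‖1 - herm z w - l‖ < ε * ‖l‖) :
    ‖l‖ ^ (-((N : ℝ) + 1 + a)) / 2 ≤ (kernel a z w *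
      (((‖l‖ ^ (-((N : ℝ) + 1 + a)) : ℝ) : ℂ) * l ^ (((N : ℝ) + 1 + a : ℝ) : ℂ))).re := by
  set α := (N : ℝ) + 1 + a
  have hl0 : l ≠ 0 := by rintro rfl; simp at hl
  have hln : 0 < ‖l‖ := norm_pos_iff.mpr hl0
  set y := (1 - herm z w) / l with hy
  have hxy : 1 - herm z w = l * y := by rw [hy]; field_simp
  have hy1 : ‖y - 1‖ < ε := by
    have : y - 1 = (1 - herm z w - l) / l := by rw [hy]; field_simp
    rw [this, norm_div, div_lt_iff₀ hln]
    exact h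
  have hyre : 0 < y.re := by
    have h1 := (Complex.abs_re_le_norm (y - 1)).trans_lt hy1
    have h2 := (abs_lt.mp h1).1
    simp only [Complex.sub_re, Complex.one_re] at h2
    linarith
  have hy0 : y ≠ 0 := by intro h; rw [h] at hyre; simp at hyre
  -- Both arguments lie in `(-π/2, π/2)`, so their sum is again principal.
  have hpow : (l * y) ^ (α : ℂ) = l ^ (α : ℂ) * y ^ (α : ℂ) := by
    have h1 := abs_lt.mp (Complex.abs_arg_lt_pi_div_two_iff.mpr (Or.inl hl))
    have h2 := abs_lt.mp (Complex.abs_arg_lt_pi_div_two_iff.mpr (Or.inl hyre))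
    rw [Complex.cpow_def_of_ne_zero (mul_ne_zero hl0 hy0), Complex.cpow_def_of_ne_zero hl0,
      Complex.cpow_def_of_ne_zero hy0, (Complex.log_mul_eq_add_log_iff hl0 hy0).mpr
        ⟨by linarith, by linarith⟩, add_mul, Complex.exp_add]
  have hlp : l ^ (α : ℂ) ≠ 0 := by simp [Complex.cpow_eq_zero_iff, hl0]
  rw [kernel_eq ha, hxy, hpow]
  have e : 1 / (l ^ (α : ℂ) * y ^ (α : ℂ)) * (((‖l‖ ^ (-α) : ℝ) : ℂ) * l ^ (α : ℂ)) =
      ((‖l‖ ^ (-α) : ℝ) : ℂ) * (1 / y ^ (α : ℂ)) := by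
    field_simp
  rw [e, Complex.re_ofReal_mul]
  have := mul_le_mul_of_nonneg_left (hε y hy1) (Real.rpow_nonneg hln.le (-α))
  linarith

lemma norm_direction {l : ℂ} (hl : l ≠ 0) (α : ℝ) :
    ‖((‖l‖ ^ (-α) : ℝ) : ℂ) * l ^ (α : ℂ)‖ ≤ 1 := by
  have hln : 0 < ‖l‖ := norm_pos_iff.mpr hl
  rw [norm_mul, Complex.norm_real, Real.norm_of_nonneg (Real.rpow_nonneg hln.le _),
    Complex.norm_cpow_real, ← Real.rpow_add hln]
  simp

/-- A quasi-triangle inequality through `η`. Splitting along `η`, the radial parts contribute `ρ`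
each; the tangential parts have squared norm at most `1 - |⟨x,η⟩|² ≤ 2ρ`, so their product
contributes `2ρ`. -/
lemma norm_one_sub_herm_le {η : CSpace N} (hη : ‖η‖ = 1) {z w : CSpace N} (hz : ‖z‖ ≤ 1)
    (hw : ‖w‖ ≤ 1) {ρ : ℝ} (hzρ : ‖1 - herm z η‖ ≤ ρ) (hwρ : ‖1 - herm w η‖ ≤ ρ) :
    ‖1 - herm z w‖ ≤ 4 * ρ := by
  have tang : ∀ x : CSpace N, ‖x‖ ≤ 1 → ‖1 - herm x η‖ ≤ ρ →
      ‖x - herm x η • η‖ ^ 2 ≤ 2 * ρ := by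
    intro x hx hxρ
    have h1 := norm_sq_eq_herm_add hη x
    have h2 : 1 - ‖herm x η‖ ≤ ‖1 - herm x η‖ := by
      simpa using norm_sub_norm_le (1 : ℂ) (herm x η)
    have h3 : ‖herm x η‖ ≤ 1 := by
      have := norm_herm_le x η
      rw [hη] at this; linarith
    nlinarith [norm_nonneg (herm x η), norm_nonneg x]
  have hx := tang z hz hzρ
  have hy := tang w hw hwρ
  set z' := z - herm z η • η
  set w' := w - herm w η • η
  have hin : herm z' w' = herm z w - herm z η * herm η w := by
    simp only [z', w', herm_sub_left, herm_sub_right, herm_smul_left, herm_smul_right,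
      herm_self_of_unit hη, herm_conj]
    ring
  have hprod : ‖herm z' w'‖ ≤ 2 * ρ := by
    refine (norm_herm_le z' w').trans ?_
    nlinarith [sq_nonneg (‖z'‖ - ‖w'‖)]
  have hza : ‖herm z η‖ ≤ 1 := by
    have := norm_herm_le z η
    rw [hη] at this; linarith
  have hw2 : ‖1 - herm η w‖ ≤ ρ := by
    have : 1 - herm η w = (starRingEnd ℂ) (1 - herm w η) := by
      rw [map_sub, map_one, herm_conj]
    rwa [this, Complex.norm_conj]
  have e : 1 - herm z w = (1 - herm z η) + herm z η * (1 - herm η w) - herm z' w' := by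
    rw [hin]; ring
  rw [e]
  calc _ ≤ ‖1 - herm z η‖ + ‖herm z η‖ * ‖1 - herm η w‖ + ‖herm z' w'‖ := by
        refine (norm_sub_le _ _).trans ?_
        gcongr
        refine (norm_add_le _ _).trans ?_
        rw [norm_mul]
    _ ≤ ρ + 1 * ρ + 2 * ρ := by gcongr
    _ = 4 * ρ := by ring

lemma exists_unimodular {τ : ℝ} (h0 : 0 < τ) (h1 : τ ≤ 1) :
    ∃ v : ℂ, ‖v‖ = 1 ∧ ‖1 - v‖ = τ ∧ 0 < (1 - v).re := by
  have hs : (0 : ℝ) ≤ 1 - τ ^ 2 / 4 := by nlinarith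
  have hsq := Real.sq_sqrt hs
  -- The point of the unit circle at chord distance `τ` from `1`.
  refine ⟨⟨1 - τ ^ 2 / 2, τ * √(1 - τ ^ 2 / 4)⟩, ?_, ?_, ?_⟩
  · rw [← sq_eq_sq₀ (norm_nonneg _) zero_le_one, ← Complex.normSq_eq_norm_sq,
      Complex.normSq_mk]
    linear_combination τ ^ 2 * hsq
  · rw [← sq_eq_sq₀ (norm_nonneg _) h0.le, ← Complex.normSq_eq_norm_sq, Complex.normSq_apply]
    simp only [Complex.sub_re, Complex.sub_im, Complex.one_re, Complex.one_im]
    linear_combination τ ^ 2 * hsq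
  · simp only [Complex.sub_re, Complex.one_re]
    nlinarith

/-! ### Anisotropic boxes near the sphere. -/

/-- The anisotropic dilation: factor `r` along `η` and `√r` on its complement, up to `1/32`. -/
noncomputable def anisoMap (η : CSpace N) (r : ℝ) : CSpace N →ₗ[ℂ] CSpace N :=
  ((√r / 32 : ℝ) : ℂ) •
    LinearMap.transvection (innerSL ℂ η).toLinearMap (((√r - 1 : ℝ) : ℂ) • η)

lemma anisoMap_apply (η : CSpace N) (r : ℝ) (x : CSpace N) :
    anisoMap η r x =
      ((√r / 32 : ℝ) : ℂ) • (x + herm x η • ((√r - 1 : ℝ) : ℂ) • η) := by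
  simp [anisoMap, LinearMap.transvection.apply, herm]

lemma det_anisoMap {η : CSpace N} (hη : ‖η‖ = 1) (r : ℝ) :
    LinearMap.det (anisoMap η r) = (((√r / 32) ^ N * √r : ℝ) : ℂ) := by
  rw [anisoMap, LinearMap.det_smul, LinearMap.transvection.det, finrank_euclideanSpace,
    Fintype.card_fin]
  have : (innerSL ℂ η).toLinearMap (((√r - 1 : ℝ) : ℂ) • η) = ((√r - 1 : ℝ) : ℂ) := by
    change herm _ η = _
    rw [herm_smul_left, herm_self_of_unit hη, mul_one]
  rw [this]
  push_cast; ring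

/-- A compact region of size `r` at distance comparable to `r` from the boundary point `η`. -/
noncomputable def anisoBox (η : CSpace N) (r : ℝ) : Set (CSpace N) :=
  (fun x => ((1 - r / 2 : ℝ) : ℂ) • η + x) '' (anisoMap η r '' Metric.closedBall 0 1)

lemma isCompact_anisoBox (η : CSpace N) (r : ℝ) : IsCompact (anisoBox η r) :=
  ((isCompact_closedBall 0 1).image (anisoMap η r).continuous_of_finiteDimensional).image
    (by fun_prop)

/-- The real determinant is the squared modulus of the complex one: the direction `η` contributes
`r²` and each of the other `N-1` contributes `r`, up to powers of `1/32`. -/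
lemma volume_anisoBox {η : CSpace N} (hη : ‖η‖ = 1) {r : ℝ} (hr : 0 ≤ r) :
    volume (anisoBox η r) = ENNReal.ofReal ((1 / 32) ^ (2 * N) * r ^ (N + 1)) *
      volume (unitBall N) := by
  have : Nontrivial (CSpace N) := nontrivial_of_ne η 0 (by rintro rfl; simp at hη)
  have h1 : volume (anisoBox η r) = volume (anisoMap η r '' Metric.closedBall 0 1) := by
    rw [anisoBox, Set.image_add_left, measure_preimage_add]
  have h2 := Measure.addHaar_image_linearMap (volume : Measure (CSpace N))
    ((anisoMap η r).restrictScalars ℝ) (Metric.closedBall 0 1)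
  rw [LinearMap.det_restrictScalars, det_anisoMap hη, Algebra.norm_complex_eq] at h2
  rw [h1, unitBall, ← Measure.addHaar_closedBall_eq_addHaar_ball]
  refine h2.trans ?_
  congr 2
  have hrs : √r ^ 2 = r := Real.sq_sqrt hr
  have h3 : Complex.normSq (((√r / 32) ^ N * √r : ℝ) : ℂ) =
      (1 / 32) ^ (2 * N) * r ^ (N + 1) := by
    rw [Complex.normSq_ofReal]
    calc _ = (1 / 32) ^ (2 * N) * (√r ^ 2) ^ (N + 1) := by ring
      _ = _ := by rw [hrs]
  exact (congrArg abs h3).trans (abs_of_nonneg (by positivity))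

/-- The tangential part has size `√r`, but by Pythagoras only its square, at most `r/1024`, affects
the norm; hence `1-|z|` is comparable to `r`. -/
lemma mem_anisoBox {η : CSpace N} (hη : ‖η‖ = 1) {r : ℝ} (hr : 0 < r) (hr1 : r ≤ 1)
    {z : CSpace N} (hz : z ∈ anisoBox η r) :
    ‖herm z η - ((1 - r / 2 : ℝ) : ℂ)‖ ≤ r / 32 ∧ 1 - r / 2 - r / 32 ≤ ‖z‖ ∧
      ‖z‖ ≤ 1 - r / 2 + r / 16 := by
  obtain ⟨_, ⟨x, hx, rfl⟩, rfl⟩ := hz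
  have hx1 : ‖x‖ ≤ 1 := by simpa using hx
  set z := ((1 - r / 2 : ℝ) : ℂ) • η + anisoMap η r x with hzdef
  have hrs : √r * √r = r := Real.mul_self_sqrt hr.le
  have hxη : ‖herm x η‖ ≤ 1 := by
    have := norm_herm_le x η
    rw [hη] at this; linarith
  have h1 : herm z η = ((1 - r / 2 : ℝ) : ℂ) + ((r / 32 : ℝ) : ℂ) * herm x η := by
    rw [hzdef, anisoMap_apply, herm_add_left]
    simp only [herm_smul_left, herm_add_left, herm_self_of_unit hη]
    have : ((r / 32 : ℝ) : ℂ) = ((√r / 32 : ℝ) : ℂ) * ((√r : ℝ) : ℂ) := by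
      rw [← Complex.ofReal_mul]; congr 1; linarith
    rw [this]; push_cast; ring
  have h2 : z - herm z η • η = ((√r / 32 : ℝ) : ℂ) • (x - herm x η • η) := by
    rw [h1, hzdef, anisoMap_apply]
    have : ((r / 32 : ℝ) : ℂ) = ((√r / 32 : ℝ) : ℂ) * ((√r : ℝ) : ℂ) := by
      rw [← Complex.ofReal_mul]; congr 1; linarith
    rw [this]; push_cast; module
  have h3 : ‖x - herm x η • η‖ ^ 2 ≤ 1 := by
    have := norm_sq_eq_herm_add hη x
    nlinarith [norm_nonneg x, sq_nonneg ‖herm x η‖]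
  have h4 : ‖z - herm z η • η‖ ^ 2 ≤ r / 1024 := by
    rw [h2, norm_smul, mul_pow, Complex.norm_real, Real.norm_of_nonneg (by positivity)]
    have : (√r / 32) ^ 2 = r / 1024 := by rw [div_pow, sq, hrs]; norm_num
    rw [this]
    exact mul_le_of_le_one_right (by positivity) h3
  have h5 : ‖herm z η - ((1 - r / 2 : ℝ) : ℂ)‖ ≤ r / 32 := by
    rw [h1, add_sub_cancel_left, norm_mul, Complex.norm_real,
      Real.norm_of_nonneg (by positivity)]
    exact mul_le_of_le_one_right (by positivity) hxη
  have hn : ‖((1 - r / 2 : ℝ) : ℂ)‖ = 1 - r / 2 := by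
    rw [Complex.norm_real, Real.norm_of_nonneg (by linarith)]
  have h6 : |‖herm z η‖ - (1 - r / 2)| ≤ r / 32 := by
    have := abs_norm_sub_norm_le (herm z η) ((1 - r / 2 : ℝ) : ℂ)
    rw [hn] at this; exact this.trans h5
  have h7 := norm_sq_eq_herm_add hη z
  have h8 := abs_le.mp h6
  refine ⟨h5, ?_, ?_⟩
  · have : ‖herm z η‖ ≤ ‖z‖ := by
      have := norm_herm_le z η
      rwa [hη, mul_one] at this
    linarith
  · refine abs_le_of_sq_le_sq' ?_ (by linarith) |>.2
    rw [h7]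
    nlinarith [norm_nonneg (herm z η)]

lemma anisoBox_subset_unitBall {η : CSpace N} (hη : ‖η‖ = 1) {r : ℝ} (hr : 0 < r)
    (hr1 : r ≤ 1) : anisoBox η r ⊆ unitBall N := by
  intro z hz
  have := (mem_anisoBox hη hr hr1 hz).2.2
  simp only [unitBall, mem_ball_zero_iff]
  linarith

lemma exists_unit (hN : 1 ≤ N) : ∃ η : CSpace N, ‖η‖ = 1 :=
  ⟨EuclideanSpace.single ⟨0, hN⟩ 1, by simp⟩

/-! ### Pseudo-balls touching the sphere. -/

lemma measurableSet_pseudoBall (ζ : CSpace N) (R : ℝ) : MeasurableSet (pseudoBall ζ R) := by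
  have hm : Measurable fun z => pseudoDist z ζ := by
    unfold pseudoDist
    have := (continuous_herm_left ζ).measurable
    refine Measurable.ite ?_ (by fun_prop) (by fun_prop)
    by_cases h : ζ = 0
    · simp [h]
    · simp [h]
  exact measurableSet_unitBall.inter (measurableSet_lt hm measurable_const)

lemma one_sub_norm_lt_of_touches {ζ : CSpace N} {R : ℝ} (hζ : ζ ∈ unitBall N)
    (h : TouchesBoundary ζ R) : 1 - ‖ζ‖ < R := by
  have hζ' : ‖ζ‖ < 1 := by simpa [unitBall] using hζ
  obtain ⟨z, hz, hd⟩ := h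
  unfold pseudoDist at hd
  split_ifs at hd with h0
  · have := norm_nonneg ζ
    linarith
  · have := le_abs_self (‖z‖ - ‖ζ‖)
    have := norm_nonneg (1 - herm z ζ / ((‖z‖ * ‖ζ‖ : ℝ) : ℂ))
    linarith

lemma herm_normalized (z ζ : CSpace N) :
    herm z (((‖ζ‖⁻¹ : ℝ) : ℂ) • ζ) = ((‖ζ‖⁻¹ : ℝ) : ℂ) * herm z ζ := by
  rw [herm_smul_right, Complex.conj_ofReal]

lemma norm_normalized {ζ : CSpace N} (h : ζ ≠ 0) : ‖((‖ζ‖⁻¹ : ℝ) : ℂ) • ζ‖ = 1 := by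
  have := norm_pos_iff.mpr h
  rw [norm_smul, Complex.norm_real, Real.norm_of_nonneg (by positivity)]
  field_simp

lemma norm_one_sub_herm_le_of_mem_pseudoBall {ζ z : CSpace N} {R : ℝ} (hR : R ≤ 1 / 2)
    (hζ : 1 - ‖ζ‖ < R) (hζ1 : ‖ζ‖ < 1) (hz : z ∈ pseudoBall ζ R) :
    ‖1 - herm z (((‖ζ‖⁻¹ : ℝ) : ℂ) • ζ)‖ ≤ 3 * R := by
  obtain ⟨hzb, hd⟩ := hz
  have hz1 : ‖z‖ < 1 := by simpa [unitBall] using hzb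
  have hζ0 : 0 < ‖ζ‖ := by linarith
  unfold pseudoDist at hd
  split_ifs at hd with h0
  -- Here `z = 0` or `ζ = 0`; both are excluded, since `‖ζ‖ > 1 - R ≥ R`.
  · have := norm_nonneg z
    linarith
  · push Not at h0
    have hz0 : 0 < ‖z‖ := norm_pos_iff.mpr h0.1
    have hz0' : (‖z‖ : ℂ) ≠ 0 := by exact_mod_cast hz0.ne'
    have hζ0' : (‖ζ‖ : ℂ) ≠ 0 := by exact_mod_cast hζ0.ne'
    have e : 1 - herm z (((‖ζ‖⁻¹ : ℝ) : ℂ) • ζ) = ((1 - ‖z‖ : ℝ) : ℂ) +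
        (‖z‖ : ℂ) * (1 - herm z ζ / ((‖z‖ * ‖ζ‖ : ℝ) : ℂ)) := by
      rw [herm_normalized]; push_cast; field_simp; ring
    set x := 1 - herm z ζ / ((‖z‖ * ‖ζ‖ : ℝ) : ℂ)
    rw [e]
    refine (norm_add_le _ _).trans ?_
    rw [norm_mul, Complex.norm_real, Complex.norm_real, norm_norm,
      Real.norm_of_nonneg (by linarith)]
    have h1 := neg_abs_le (‖z‖ - ‖ζ‖)
    have h2 := abs_nonneg (‖z‖ - ‖ζ‖)
    have h3 : ‖z‖ * ‖x‖ ≤ ‖x‖ := mul_le_of_le_one_left (norm_nonneg _) hz1.le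
    have := norm_nonneg x
    linarith

/-- Serves to bound the measure of a pseudo-ball from below. Size `R/3` keeps the box parameter at
most `1` for `R ≤ 3`. -/
lemma exists_anisoBox_subset_pseudoBall (hN : 1 ≤ N) {ζ : CSpace N} {R : ℝ} (hR0 : 0 < R)
    (hR : R ≤ 3) (hζ : 1 - ‖ζ‖ < R) (hζ1 : ‖ζ‖ < 1) :
    ∃ η : CSpace N, ‖η‖ = 1 ∧ anisoBox η (R / 3) ⊆ pseudoBall ζ R := by
  rcases eq_or_ne ζ 0 with h | h
  · obtain ⟨η, hη⟩ := exists_unit hN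
    refine ⟨η, hη, fun z hz => ?_⟩
    have hb := anisoBox_subset_unitBall hη (by positivity) (by linarith) hz
    refine ⟨hb, ?_⟩
    have hz1 : ‖z‖ < 1 := by simpa [unitBall] using hb
    rw [h, norm_zero] at hζ
    simp only [pseudoDist, h, or_true, if_true, norm_zero]
    linarith
  · refine ⟨_, norm_normalized h, fun z hz => ?_⟩
    have hr : 0 < R / 3 := by positivity
    have hr1 : R / 3 ≤ 1 := by linarith
    have hb := anisoBox_subset_unitBall (norm_normalized h) hr hr1 hz
    refine ⟨hb, ?_⟩
    obtain ⟨h1, h2, h3⟩ := mem_anisoBox (norm_normalized h) hr hr1 hz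
    set r := R / 3 with hrdef
    have hζ0 : 0 < ‖ζ‖ := norm_pos_iff.mpr h
    have hz0 : 7 / 16 ≤ ‖z‖ := by linarith
    have hzne : z ≠ 0 := by rintro rfl; norm_num at hz0
    have hz0' : (‖z‖ : ℂ) ≠ 0 := by
      have : ‖z‖ ≠ 0 := by linarith
      exact_mod_cast this
    have hζ0' : (‖ζ‖ : ℂ) ≠ 0 := by exact_mod_cast hζ0.ne'
    rw [pseudoDist, if_neg (by tauto)]
    set η := ((‖ζ‖⁻¹ : ℝ) : ℂ) • ζ with hη
    have e : 1 - herm z ζ / ((‖z‖ * ‖ζ‖ : ℝ) : ℂ) = ((‖z‖ : ℂ) - herm z η) / (‖z‖ : ℂ) := by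
      rw [hη, herm_normalized]; push_cast; field_simp
    have h4 : ‖(‖z‖ : ℂ) - herm z η‖ ≤ 3 * r / 32 := by
      have e2 : (‖z‖ : ℂ) - herm z η = ((‖z‖ - (1 - r / 2) : ℝ) : ℂ) -
          (herm z η - ((1 - r / 2 : ℝ) : ℂ)) := by push_cast; ring
      rw [e2]
      refine (norm_sub_le _ _).trans ?_
      rw [Complex.norm_real, Real.norm_eq_abs]
      have : |‖z‖ - (1 - r / 2)| ≤ r / 16 := abs_le.mpr ⟨by linarith, by linarith⟩
      linarith
    have h5 : ‖1 - herm z ζ / ((‖z‖ * ‖ζ‖ : ℝ) : ℂ)‖ ≤ 7 * r / 32 := by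
      rw [e, norm_div, Complex.norm_real, norm_norm, div_le_iff₀ (by linarith)]
      nlinarith
    have h6 : |‖z‖ - ‖ζ‖| < R - 7 * r / 32 := abs_lt.mpr ⟨by linarith, by linarith⟩
    linarith

/-! ### Measure estimates and the normalizing factor. -/

lemma muMeasure_ge {a r : ℝ} (hr : 0 < r) {S : Set (CSpace N)} (hS : MeasurableSet S)
    (h : ∀ z ∈ S, r / 4 ≤ 1 - ‖z‖ ^ 2 ∧ 1 - ‖z‖ ^ 2 ≤ 2 * r) :
    ENNReal.ofReal (min ((1 / 4) ^ a) (2 ^ a) * r ^ a) * ballMeasure N S ≤ muMeasure N a S := by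
  rw [muMeasure, withDensity_apply _ hS, ← setLIntegral_const]
  refine setLIntegral_mono' hS fun z hz => ENNReal.ofReal_le_ofReal ?_
  obtain ⟨h1, h2⟩ := h z hz
  have hr4 : 0 < r / 4 := by positivity
  rcases le_total 0 a with ha | ha
  · calc _ ≤ (1 / 4) ^ a * r ^ a := by gcongr; exact min_le_left _ _
      _ = (r / 4) ^ a := by
        rw [← Real.mul_rpow (by norm_num) hr.le]; congr 1; ring
      _ ≤ _ := Real.rpow_le_rpow hr4.le h1 ha
  · calc _ ≤ 2 ^ a * r ^ a := by gcongr; exact min_le_right _ _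
      _ = (2 * r) ^ a := by rw [← Real.mul_rpow (by norm_num) hr.le]
      _ ≤ _ := Real.rpow_le_rpow_of_nonpos (by linarith) h2 ha

lemma ballMeasure_anisoBox {η : CSpace N} (hη : ‖η‖ = 1) {r : ℝ} (hr : 0 < r) (hr1 : r ≤ 1) :
    ballMeasure N (anisoBox η r) = ENNReal.ofReal ((1 / 32) ^ (2 * N) * r ^ (N + 1)) := by
  rw [ballMeasure, Measure.smul_apply, Measure.restrict_apply
    (isCompact_anisoBox η r).measurableSet,
    Set.inter_eq_left.mpr (anisoBox_subset_unitBall hη hr hr1), volume_anisoBox hη hr.le,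
    smul_eq_mul, mul_left_comm, ENNReal.inv_mul_cancel, mul_one]
  · exact (Metric.isOpen_ball.measure_pos _ ⟨0, by simp⟩).ne'
  · exact measure_ball_lt_top.ne

/-- On the box `1-|z|²` is comparable to `r`, so the density is comparable to `r^a` for every real
`a`, even where `μ_a` is infinite. -/
lemma exists_muMeasure_anisoBox_ge (N : ℕ) (a : ℝ) :
    ∃ c : ℝ, 0 < c ∧ ∀ η : CSpace N, ‖η‖ = 1 → ∀ r : ℝ, 0 < r → r ≤ 1 →
      ENNReal.ofReal (c * r ^ ((N : ℝ) + 1 + a)) ≤ muMeasure N a (anisoBox η r) := by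
  refine ⟨min ((1 / 4) ^ a) (2 ^ a) * (1 / 32) ^ (2 * N), by positivity, ?_⟩
  intro η hη r hr hr1
  refine le_trans (le_of_eq ?_) (muMeasure_ge hr (isCompact_anisoBox η r).measurableSet ?_)
  · rw [ballMeasure_anisoBox hη hr hr1, ← ENNReal.ofReal_mul (by positivity)]
    congr 1
    have : r ^ ((N : ℝ) + 1 + a) = r ^ (N + 1) * r ^ a := by
      rw [Real.rpow_add hr, ← Real.rpow_natCast]; push_cast; rfl
    rw [this]; ring
  · intro z hz
    obtain ⟨-, h2, h3⟩ := mem_anisoBox hη hr hr1 hz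
    constructor <;> nlinarith [norm_nonneg z]

lemma exists_kFactor_le (hN : 1 ≤ N) (p s t q Q : ℝ) :
    ∃ D : ℝ, 0 < D ∧ ∀ (ζ : CSpace N) (R : ℝ), ζ ∈ unitBall N → 0 < R → R ≤ 3 →
      TouchesBoundary ζ R →
        kFactor p s t q Q ζ R ≤
          ENNReal.ofReal (D * R ^ ((Q - q) / p - ((N : ℝ) + 1 + (s + t)))) := by
  obtain ⟨c, hc, hbox⟩ := exists_muMeasure_anisoBox_ge N (s + t)
  set α := (N : ℝ) + 1 + (s + t)
  refine ⟨max 1 (c * (1 / 3) ^ α)⁻¹, by positivity, fun ζ R hζ hR0 hR ht => ?_⟩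
  have hζ1 : ‖ζ‖ < 1 := by simpa [unitBall] using hζ
  have hsub : R ^ ((Q - q) / p - α) = R ^ ((Q - q) / p) / R ^ α := Real.rpow_sub hR0 _ _
  have key : ∀ d : ℝ, 0 < d → ∀ x : ℝ≥0∞, ENNReal.ofReal (d * R ^ α) ≤ x →
      ENNReal.ofReal (R ^ ((Q - q) / p)) / x ≤
        ENNReal.ofReal (d⁻¹ * R ^ ((Q - q) / p - α)) := by
    intro d hd x hx
    refine (ENNReal.div_le_div_left hx _).trans (le_of_eq ?_)
    rw [← ENNReal.ofReal_div_of_pos (by positivity), hsub]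
    congr 1
    field_simp
  have mono : ∀ d : ℝ, d ≤ max 1 (c * (1 / 3) ^ α)⁻¹ →
      ENNReal.ofReal (d * R ^ ((Q - q) / p - α)) ≤
        ENNReal.ofReal (max 1 (c * (1 / 3) ^ α)⁻¹ * R ^ ((Q - q) / p - α)) := by
    intro d hd
    gcongr
  rw [kFactor]
  split_ifs with h
  · obtain ⟨η, hη, hsubset⟩ := exists_anisoBox_subset_pseudoBall hN hR0 hR
      (one_sub_norm_lt_of_touches hζ ht) hζ1
    refine (key (c * (1 / 3) ^ α) (by positivity) _ ?_).trans (mono _ (le_max_right _ _))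
    refine le_trans (le_of_eq ?_) ((hbox η hη (R / 3) (by positivity) (by linarith)).trans
      (measure_mono hsubset))
    rw [mul_assoc, ← Real.mul_rpow (by norm_num) hR0.le]
    congr 3; ring
  · refine (key 1 one_pos _ (le_of_eq ?_)).trans (mono _ (by simp))
    rw [one_mul]
    congr 2; simp only [α]; ring

/-! ### The companion set. -/

/-- Every pseudo-ball that reaches the boundary has a compact companion such that the kernel points
in a fixed direction on their product. -/
lemma exists_companion {a : ℝ} (ha : -((N : ℝ) + 1) < a) (b : ℝ) :
    ∃ c : ℝ, 0 < c ∧ ∀ (ζ : CSpace N) (R : ℝ), ζ ∈ unitBall N → 0 < R → R ≤ 3 →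
      TouchesBoundary ζ R → ∃ (B : Set (CSpace N)) (u : ℂ) (k : ℝ), IsCompact B ∧
        B ⊆ unitBall N ∧ ‖u‖ ≤ 1 ∧ 0 ≤ k ∧
        (∀ z ∈ pseudoBall ζ R, ∀ w ∈ B, k ≤ (kernel a z w * u).re) ∧
        ENNReal.ofReal (c * R ^ (b - ((N : ℝ) + 1 + a))) ≤
          ENNReal.ofReal k ^ 2 * muMeasure N (a + b) B := by
  obtain ⟨ε, hε0, hε2, hε⟩ := exists_half_le_re_inv_cpow ((N : ℝ) + 1 + a)
  obtain ⟨c, hc, hbox⟩ := exists_muMeasure_anisoBox_ge N (a + b)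
  set α := (N : ℝ) + 1 + a with hα
  set S : Set (CSpace N) := Metric.closedBall 0 (ε / 2) with hS
  have hSm : MeasurableSet S := measurableSet_closedBall
  have hSb : S ⊆ unitBall N := Metric.closedBall_subset_ball (by linarith)
  -- The quasi-triangle inequality below yields the error `4 * 3R = 12R`; it must be strictly less
  -- than `ε R / R₀ = 13R`.
  set R₀ := ε / 13 with hR₀
  have hR₀0 : 0 < R₀ := by positivity
  obtain ⟨d, hd, hdS⟩ : ∃ d : ℝ, 0 < d ∧ ENNReal.ofReal d ≤ muMeasure N (a + b) S := by
    have h1 := muMeasure_ge (a := a + b) (r := 1 / 2) (by norm_num) hSm (fun z hz => by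
      have : ‖z‖ ≤ ε / 2 := by simpa [hS] using hz
      constructor <;> nlinarith [norm_nonneg z])
    have h2 : 0 < ballMeasure N S := by
      rw [ballMeasure, Measure.smul_apply, Measure.restrict_apply hSm,
        Set.inter_eq_left.mpr hSb, smul_eq_mul]
      refine ENNReal.mul_pos (ENNReal.inv_ne_zero.mpr measure_ball_lt_top.ne) ?_
      exact (Metric.measure_closedBall_pos _ _ (by positivity)).ne'
    have h3 : 0 < muMeasure N (a + b) S := lt_of_lt_of_le
      (ENNReal.mul_pos (by simp only [ne_eq, ENNReal.ofReal_eq_zero, not_le]; positivity)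
        h2.ne') h1
    obtain ⟨d, hd0, hd⟩ := ENNReal.lt_iff_exists_nnreal_btwn.mp h3
    exact ⟨d, by exact_mod_cast hd0, by simpa using hd.le⟩
  set c₁ := R₀ ^ (2 * α) / 4 * (c * (1 / 3) ^ (α + b)) with hc₁
  -- The denominator bounds `R^{b-α}` on `[R₀, 3]` for either sign of the exponent.
  set c₂ := 1 / 4 * d / (R₀ ^ (b - α) + 3 ^ (b - α)) with hc₂
  have hc₁0 : 0 < c₁ := by positivity
  have hc₂0 : 0 < c₂ := by positivity
  refine ⟨min c₁ c₂, lt_min hc₁0 hc₂0, fun ζ R hζ hR0 hR ht => ?_⟩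
  have hζ1 : ‖ζ‖ < 1 := by simpa [unitBall] using hζ
  have hζR := one_sub_norm_lt_of_touches hζ ht
  -- Small pseudo-balls get a rotated box near the sphere; for the others a fixed small ball at the
  -- origin suffices, since there the kernel is close to `1`.
  rcases le_total R R₀ with hRs | hRb
  · have hRhalf : R ≤ 1 / 2 := by linarith
    have hζ0 : ζ ≠ 0 := by rintro rfl; simp at hζR; linarith
    set η := ((‖ζ‖⁻¹ : ℝ) : ℂ) • ζ with hη
    have hη1 : ‖η‖ = 1 := norm_normalized hζ0
    set τ := R / R₀ with hτ
    have hτ0 : 0 < τ := by positivity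
    have hτ1 : τ ≤ 1 := (div_le_one hR₀0).mpr hRs
    obtain ⟨v, hv, hvτ, hvre⟩ := exists_unimodular hτ0 hτ1
    have hvv : v * (starRingEnd ℂ) v = 1 := by
      rw [Complex.mul_conj, Complex.normSq_eq_norm_sq, hv]; norm_num
    -- Rotated so that `⟨η, η'⟩ = v`: for `z` near `η` and `w` near `η'`, `1-⟨z,w⟩` is close to
    -- `1-v`, of modulus `τ`. A rotation by a scalar works in every dimension, including `N = 1`.
    set η' := (starRingEnd ℂ) v • η with hη'
    have hη'1 : ‖η'‖ = 1 := by rw [hη', norm_smul, Complex.norm_conj, hv, hη1, one_mul]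
    have hr0 : 0 < R / 3 := by positivity
    have hr1 : R / 3 ≤ 1 := by linarith
    have hl0 : 1 - v ≠ 0 := by rw [← norm_pos_iff, hvτ]; exact hτ0
    refine ⟨anisoBox η' (R / 3), _, ‖1 - v‖ ^ (-α) / 2, isCompact_anisoBox _ _,
      anisoBox_subset_unitBall hη'1 hr0 hr1, norm_direction hl0 α, by positivity, ?_, ?_⟩
    · intro z hz w hw
      refine kernel_direction ha hε2 hε hvre ?_
      have hwb := anisoBox_subset_unitBall hη'1 hr0 hr1 hw
      have hz1 : ‖z‖ ≤ 1 := by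
        have : ‖z‖ < 1 := by simpa [unitBall] using hz.1
        exact this.le
      have hw1 : ‖v • w‖ ≤ 1 := by
        have : ‖w‖ < 1 := by simpa [unitBall] using hwb
        rw [norm_smul, hv, one_mul]; exact this.le
      have hzη := norm_one_sub_herm_le_of_mem_pseudoBall hRhalf hζR hζ1 hz
      have hwη : ‖1 - herm (v • w) η‖ ≤ 3 * R := by
        have h1 := (mem_anisoBox hη'1 hr0 hr1 hw).1
        have e : herm (v • w) η = herm w η' := by
          rw [hη', herm_smul_left, herm_smul_right _ η w, Complex.conj_conj]
        have e2 : 1 - herm w η' = ((R / 3 / 2 : ℝ) : ℂ) -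
            (herm w η' - ((1 - R / 3 / 2 : ℝ) : ℂ)) := by push_cast; ring
        rw [e, e2]
        refine (norm_sub_le _ _).trans ?_
        rw [Complex.norm_real, Real.norm_of_nonneg (by positivity)]
        linarith
      have h4 := norm_one_sub_herm_le hη1 hz1 hw1 hzη hwη
      -- Undoing the rotation of `w` reduces the error to two points near the same `η`.
      have e3 : 1 - herm z w - (1 - v) = v * (1 - herm z (v • w)) := by
        rw [herm_smul_right]
        linear_combination herm z w * hvv
      rw [e3, norm_mul, hv, one_mul, hvτ]
      have : ε * τ = 13 * R := by rw [hτ, hR₀]; field_simp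
      rw [this]; linarith
    · have h1 := hbox η' hη'1 (R / 3) hr0 hr1
      rw [hvτ]
      calc _ ≤ ENNReal.ofReal (c₁ * R ^ (b - α)) := by gcongr; exact min_le_left _ _
        _ = ENNReal.ofReal (τ ^ (-α) / 2) ^ 2 *
            ENNReal.ofReal (c * (R / 3) ^ ((N : ℝ) + 1 + (a + b))) := by
            rw [← ENNReal.ofReal_pow (by positivity), ← ENNReal.ofReal_mul (by positivity)]
            congr 1
            have e1 : (N : ℝ) + 1 + (a + b) = α + b := by rw [hα]; ring
            have e2 : τ ^ (-α) = R₀ ^ α / R ^ α := by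
              rw [hτ, Real.rpow_neg (by positivity), Real.div_rpow hR0.le hR₀0.le, inv_div]
            have e3 : (R / 3) ^ (α + b) = (1 / 3) ^ (α + b) * (R ^ α * R ^ b) := by
              rw [← Real.rpow_add hR0, ← Real.mul_rpow (by norm_num) hR0.le]
              congr 1; ring
            have e4 : R ^ (b - α) = R ^ b / R ^ α := Real.rpow_sub hR0 _ _
            have e5 : R₀ ^ (2 * α) = R₀ ^ α * R₀ ^ α := by
              rw [two_mul, Real.rpow_add hR₀0]
            rw [e1, e2, e3, e4, hc₁, e5]
            have : R ^ α ≠ 0 := by positivity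
            field_simp
            ring
        _ ≤ _ := by gcongr
  · refine ⟨S, _, ‖(1 : ℂ)‖ ^ (-α) / 2, isCompact_closedBall _ _, hSb,
      norm_direction one_ne_zero α, by positivity, ?_, ?_⟩
    · intro z hz w hw
      refine kernel_direction ha hε2 hε (by simp) ?_
      have hz1 : ‖z‖ < 1 := by simpa [unitBall] using hz.1
      have hw1 : ‖w‖ ≤ ε / 2 := by simpa [hS] using hw
      have := norm_herm_le z w
      rw [show 1 - herm z w - 1 = -herm z w by ring, norm_neg, norm_one, mul_one]
      nlinarith [norm_nonneg w, norm_nonneg z]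
    · rw [norm_one, Real.one_rpow]
      have hRx : R ^ (b - α) ≤ R₀ ^ (b - α) + 3 ^ (b - α) := by
        have p1 : 0 < R₀ ^ (b - α) := by positivity
        have p2 : (0 : ℝ) < 3 ^ (b - α) := by positivity
        rcases le_total 0 (b - α) with hx | hx
        · have := Real.rpow_le_rpow hR0.le hR hx
          linarith
        · have := Real.rpow_le_rpow_of_nonpos hR₀0 hRb hx
          linarith
      calc _ ≤ ENNReal.ofReal (c₂ * (R₀ ^ (b - α) + 3 ^ (b - α))) := by
            gcongr; exact min_le_right _ _
        _ = ENNReal.ofReal (1 / 2) ^ 2 * ENNReal.ofReal d := by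
            rw [← ENNReal.ofReal_pow (by positivity), ← ENNReal.ofReal_mul (by positivity), hc₂]
            congr 1
            rw [div_mul_cancel₀ _ (by positivity)]; ring
        _ ≤ _ := by gcongr

end BergmanBesov

/-! ### Conclusion. -/

open BergmanBesov in
theorem mainTheorem7 (N : ℕ) (hN : 1 ≤ N) (p s t q Q : ℝ) (hp : 1 < p) (hs : -1 < s)
    (hcase : (-((N : ℝ) + 1) < s + t ∧ s + t < -1 ∧ -1 < s + t + (Q - q) / p) ∨
      (-1 < s + t ∧ q ≤ Q))
    (ω : BergmanBesov.CSpace N → ℝ) (hω : BergmanBesov.IsWeight ω)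
    (hP : BergmanBesov.IsBoundedP p s t q Q ω) :
    BergmanBesov.MemK p s t q Q ω := by
  have hp0 : 0 ≤ p := by linarith
  have ha : -((N : ℝ) + 1) < s + t := by
    rcases hcase with h | h
    · exact h.1
    · have : (0 : ℝ) ≤ N := Nat.cast_nonneg N
      linarith [h.1]
  obtain ⟨C, -, hC⟩ := hP
  replace hC : IsOpBound p s t q Q C ω := hC
  obtain ⟨D, hD, hkF⟩ := exists_kFactor_le hN p s t q Q
  obtain ⟨c, hc, hcomp⟩ := exists_companion ha ((Q - q) / p)
  refine lt_of_le_of_lt (b := ENNReal.ofReal (D / c) ^ p * (ENNReal.ofReal C ^ p) ^ 2) ?_ ?_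
  · refine iSup_le fun ζ => iSup_le fun R => iSup_le fun hζ => iSup_le fun hR =>
      iSup_le fun ht => ?_
    obtain ⟨B, u, k, hBc, hBb, hu, hk, hK, hm⟩ := hcomp ζ R hζ hR.1 hR.2 ht
    have hF := hkF ζ R hζ hR.1 hR.2 ht
    have hK' : ∀ z ∈ B, ∀ w ∈ pseudoBall ζ R,
        k ≤ (kernel (s + t) z w * (starRingEnd ℂ) u).re := by
      intro z hz w hw
      rw [kernel_conj ha hw.1 (hBb hz), ← map_mul, Complex.conj_re]
      exact hK w hw z hz
    have key := hC.two_set_bound hp hω hk hu (by rwa [Complex.norm_conj])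
      (measurableSet_pseudoBall ζ R) hBc.measurableSet hK hK'
      (hω.lintegral_compact_ne_top _ hBc hBb)
    rw [kQuantity]
    set W := ∫⁻ z in pseudoBall ζ R, ENNReal.ofReal (ω z) ∂(muMeasure N (Q + p * t))
    set G := ∫⁻ w in pseudoBall ζ R, ENNReal.ofReal (ω w) ^ (-1 / (p - 1))
          ∂(muMeasure N (q + Real.conjExponent p * (s - q)))
    set m := ENNReal.ofReal k ^ 2 * muMeasure N (s + t + (Q - q) / p) B
    set F := kFactor p s t q Q ζ R
    -- Both sides scale as `R^{b-α}`, so the constant is free of `ζ` and `R`.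
    have hFm : F ≤ ENNReal.ofReal (D / c) * m := by
      refine hF.trans (le_trans (le_of_eq ?_) (mul_le_mul_right hm _))
      have hR0 := hR.1
      rw [← ENNReal.ofReal_mul (by positivity)]
      congr 1
      field_simp
    -- The factor enters the class quantity once plainly and once to the power `p-1`, `p` times in
    -- all.
    have hpow : F ^ p = F * F ^ (p - 1) := by
      conv_lhs => rw [← add_sub_cancel 1 p]
      rw [ENNReal.rpow_add_of_nonneg _ _ zero_le_one (by linarith), ENNReal.rpow_one]
    calc _ = F ^ p * (W * G ^ (p - 1)) := by
          rw [ENNReal.mul_rpow_of_nonneg _ _ (by linarith), hpow]; ring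
      _ ≤ (ENNReal.ofReal (D / c) * m) ^ p * (W * G ^ (p - 1)) := by gcongr
      _ = ENNReal.ofReal (D / c) ^ p * (m ^ p * (W * G ^ (p - 1))) := by
          rw [ENNReal.mul_rpow_of_nonneg _ _ hp0]; ring
      _ ≤ _ := by gcongr
  · exact ENNReal.mul_lt_top (ENNReal.rpow_lt_top_of_nonneg hp0 ENNReal.ofReal_ne_top)
      (ENNReal.pow_lt_top (ENNReal.rpow_lt_top_of_nonneg hp0 ENNReal.ofReal_ne_top))
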